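/- Let $N_C, N_R, N_I$ be finite, non-empty, mutually disjoint sets of concept, role and individual names. Roles are $S ::= R \mid R^-$, basic concepts are $B ::= A \mid \exists S$, and concepts are $C ::= B \mid \neg B$ ($R\in N_R$, $A\in N_C$). A DL-Lite$^{\mathcal H}$ knowledge base (KB) $\mathcal K=(\mathcal T,\mathcal A)$ consists of a finite set $\mathcal T$ of role inclusions $S\sqsubseteq Q$ ($S,Q$ roles) and concept inclusions $B\sqsubseteq C$ and a finite set $\mathcal A$ of assertions $B(a)$, $R(a,b)$ ($R\in N_R$, $a,b\in N_I$). Inclusions and assertions are called axioms. Satisfaction of axioms and KBs in (non-empty-domain, first-order) interpretations is as usual; $\mathcal K$ is satisfiable if it has a model, $\mathcal K\models\alpha$ means that every model of $\mathcal K$ satisfies $\alpha$, and $\alpha$ is consistent with $\mathcal K$ if $\mathcal K\cup\{\alpha\}$ has a model. Fix reals $\epsilon,s$ with $0<\epsilon\le s/8$ and a dimension $d$; inequalities between vectors are coordinatewise and scalars stand for constant vectors. A box is a set $\{x\in\mathbb R^d\mid L+\epsilon\le x\le U-\epsilon\}$ with $L,U\in\mathbb R^d$ and $0\le U-L\le 2s$.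 The bounds of a non-empty set of the form $\{x\mid L+\epsilon\le x\le U-\epsilon\}$ are $L$ and $U$; those of the empty set are $L=U=0$. A box interpretation $\eta$ assigns to each $a\in N_I$ vectors $\mathrm{pos}(a),\mathrm{bump}(a)\in[-s,s]^d$, to each $A\in N_C$ a box $\eta(A)$, and to each $R\in N_R$ three boxes $H_R,T_R,B_R$ (head, tail, bump box); for inverse roles put $H_{R^-}=T_R$, $T_{R^-}=H_R$, $B_{R^-}=B_R$. For a role $S$, $$\eta(\exists S)=\{x\mid L^H_S-U^B_S+\epsilon\le x\le U^H_S-L^B_S-\epsilon\},$$ where $L^X_S,U^X_S$ are the bounds of $X_S$ for $X\in\{H,B\}$, and for a basic concept $B$ such that $\eta(B)$ has bounds $L,U$, $$\eta(\neg B)=\{x\mid -s-L+\epsilon\le x\le s-U-\epsilon\}.$$ Define $\eta\models\alpha$ by: $\eta\models S\sqsubseteq Q$ iff $H_S\subseteq H_Q$, $T_S\subseteq T_Q$ and $B_S\subseteq B_Q$; $\eta\models B\sqsubseteq C$ iff $\eta(B)\subseteq\eta(C)$; $\eta\models B(a)$ iff $\mathrm{pos}(a)\in\eta(B)$; $\eta\models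 R(a,b)$ iff $\mathrm{pos}(a)+\mathrm{bump}(b)\in H_R$, $\mathrm{pos}(b)+\mathrm{bump}(a)\in T_R$ and $\mathrm{bump}(a),\mathrm{bump}(b)\in B_R$. Call $\eta$ a KB faithful model of $\mathcal K$ if every axiom $\alpha$ with $\eta\models\alpha$ is consistent with $\mathcal K$, and every axiom $\alpha$ with $\mathcal K\models\alpha$ satisfies $\eta\models\alpha$. Theorem. Let $\mathcal K$ be a satisfiable DL-Lite$^{\mathcal H}$ KB. Then for every $d\ge |N_C|+|N_R|\,(2+|N_I|+2|N_R|)$ there is a box interpretation $\eta$ of dimension $d$ that is a KB faithful model of $\mathcal K$. -/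

import Mathlib

namespace DLLite

/-! ### Syntax of DL-Lite with role inclusions -/

/-- Roles: role names `R` and their inverses `R⁻`. -/
inductive Role (NR : Type*) where
  | name (R : NR) : Role NR
  | inv (R : NR) : Role NR

/-- Basic concepts `B ::= A | ∃S`. -/
inductive BasicConcept (NC NR : Type*) where
  | atom (A : NC) : BasicConcept NC NR
  | ex (S : Role NR) : BasicConcept NC NR

/-- Concepts `C ::= B | ¬B`. -/
inductive GenConcept (NC NR : Type*) where
  | pos (B : BasicConcept NC NR) : GenConcept NC NR
  | neg (B : BasicConcept NC NR) : GenConcept NC NR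

/-- Role inclusions `S ⊑ T` and concept inclusions `B ⊑ C`. -/
inductive Inclusion (NC NR : Type*) where
  | role (S T : Role NR) : Inclusion NC NR
  | concept (B : BasicConcept NC NR) (C : GenConcept NC NR) : Inclusion NC NR

/-- Concept assertions `D(a)` and role assertions `R(a, b)`. -/
inductive Assertion (NC NR NI : Type*) where
  | concept (D : BasicConcept NC NR) (a : NI) : Assertion NC NR NI
  | role (R : NR) (a b : NI) : Assertion NC NR NI

/-- The axioms of the language: inclusions and assertions. -/
inductive Formula (NC NR NI : Type*) where
  | incl (i : Inclusion NC NR) : Formula NC NR NI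
  | assn (p : Assertion NC NR NI) : Formula NC NR NI

/-- A knowledge base: a finite TBox and a finite ABox. -/
structure KB (NC NR NI : Type*) where
  tbox : Finset (Inclusion NC NR)
  abox : Finset (Assertion NC NR NI)

/-- `K.Mem α`: the axiom `α` belongs to the knowledge base `K`. -/
def KB.Mem {NC NR NI : Type*} (K : KB NC NR NI) : Formula NC NR NI → Prop
  | .incl i => i ∈ K.tbox
  | .assn p => p ∈ K.abox

/-! ### Classical semantics -/

/-- An interpretation with a non-empty domain. -/
structure Interp (NC NR NI : Type*) where
  Dom : Type
  nonempty : Nonempty Dom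
  conceptName : NC → Set Dom
  roleName : NR → Set (Dom × Dom)
  indiv : NI → Dom

namespace Interp

variable {NC NR NI : Type*} (I : Interp NC NR NI)

def role : Role NR → Set (I.Dom × I.Dom)
  | .name R => I.roleName R
  | .inv R => {p | (p.2, p.1) ∈ I.roleName R}

def basic : BasicConcept NC NR → Set I.Dom
  | .atom A => I.conceptName A
  | .ex S => {x | ∃ y, (x, y) ∈ I.role S}

def concept : GenConcept NC NR → Set I.Dom
  | .pos B => I.basic B
  | .neg B => (I.basic B)ᶜ

/-- `I ⊨ α`. -/
def Sat : Formula NC NR NI → Prop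
  | .incl (.role S T) => I.role S ⊆ I.role T
  | .incl (.concept B C) => I.basic B ⊆ I.concept C
  | .assn (.concept D a) => I.indiv a ∈ I.basic D
  | .assn (.role R a b) => (I.indiv a, I.indiv b) ∈ I.roleName R

/-- `I ⊨ K`. -/
def Models (K : KB NC NR NI) : Prop := ∀ α, K.Mem α → I.Sat α

end Interp

namespace KB

variable {NC NR NI : Type*} (K : KB NC NR NI)

def Satisfiable : Prop := ∃ I : Interp NC NR NI, I.Models K

/-- `K ⊨ α`. -/
def Entails (α : Formula NC NR NI) : Prop := ∀ I : Interp NC NR NI, I.Models K → I.Sat α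

/-- `α` is consistent with `K`: some interpretation satisfies `K ∪ {α}`. -/
def ConsistentWith (α : Formula NC NR NI) : Prop :=
  ∃ I : Interp NC NR NI, I.Models K ∧ I.Sat α

end KB

/-! ### Boxes -/

/-- The set `{x | L + ε ≤ x ≤ U - ε}` (coordinatewise). -/
def boxSet {d : ℕ} (ε : ℝ) (L U : Fin d → ℝ) : Set (Fin d → ℝ) :=
  {x | ∀ i, L i + ε ≤ x i ∧ x i ≤ U i - ε}

/-- Membership in the set `Box` with parameters `ε` and `s`. -/
def IsBox {d : ℕ} (ε s : ℝ) (X : Set (Fin d → ℝ)) : Prop :=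
  ∃ L U : Fin d → ℝ, (∀ i, 0 ≤ U i - L i ∧ U i - L i ≤ 2 * s) ∧ X = boxSet ε L U

/-- The universe box `[-s, s]^d`. -/
def universeBox (d : ℕ) (s : ℝ) : Set (Fin d → ℝ) := {x | ∀ i, -s ≤ x i ∧ x i ≤ s}

open Classical in
/-- The lower bound `L` of a box `X`, which is `0` for the empty box. -/
noncomputable def lowerBd {d : ℕ} (ε : ℝ) (X : Set (Fin d → ℝ)) : Fin d → ℝ :=
  if X.Nonempty then fun i => sInf ((fun x => x i) '' X) - ε else 0

open Classical in
/-- The upper bound `U` of a box `X`, which is `0` for the empty box. -/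
noncomputable def upperBd {d : ℕ} (ε : ℝ) (X : Set (Fin d → ℝ)) : Fin d → ℝ :=
  if X.Nonempty then fun i => sSup ((fun x => x i) '' X) + ε else 0

/-- `lowerBd` recovers the vector `L` from a non-empty set `{x | L + ε ≤ x ≤ U - ε}`. -/
theorem lowerBd_boxSet {d : ℕ} {ε : ℝ} {L U : Fin d → ℝ} (h : (boxSet ε L U).Nonempty) :
    lowerBd ε (boxSet ε L U) = L := by
  obtain ⟨x, hx⟩ := h
  rw [lowerBd, if_pos ⟨x, hx⟩]
  funext i
  have key : IsLeast ((fun x : Fin d → ℝ => x i) '' boxSet ε L U) (L i + ε) :=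
    ⟨⟨fun j => L j + ε, fun j => ⟨le_rfl, (hx j).1.trans (hx j).2⟩, rfl⟩,
      by rintro _ ⟨y, hy, rfl⟩; exact (hy i).1⟩
  rw [key.csInf_eq]
  ring

/-- `upperBd` recovers the vector `U` from a non-empty set `{x | L + ε ≤ x ≤ U - ε}`. -/
theorem upperBd_boxSet {d : ℕ} {ε : ℝ} {L U : Fin d → ℝ} (h : (boxSet ε L U).Nonempty) :
    upperBd ε (boxSet ε L U) = U := by
  obtain ⟨x, hx⟩ := h
  rw [upperBd, if_pos ⟨x, hx⟩]
  funext i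
  have key : IsGreatest ((fun x : Fin d → ℝ => x i) '' boxSet ε L U) (U i - ε) :=
    ⟨⟨fun j => U j - ε, fun j => ⟨(hx j).1.trans (hx j).2, le_rfl⟩, rfl⟩,
      by rintro _ ⟨y, hy, rfl⟩; exact (hy i).2⟩
  rw [key.csSup_eq]
  ring

/-- The complement box `{x | -s - L + ε ≤ x ≤ s - U - ε}` of a box with bounds `L`, `U`. -/
noncomputable def complBox {d : ℕ} (ε s : ℝ) (X : Set (Fin d → ℝ)) : Set (Fin d → ℝ) :=
  boxSet ε (fun i => -s - lowerBd ε X i) (fun i => s - upperBd ε X i)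

/-! ### Box interpretations -/

/-- A box interpretation in dimension `d` with parameters `ε` and `s`. -/
structure BoxInterp (NC NR NI : Type*) (d : ℕ) (ε s : ℝ) where
  pos : NI → Fin d → ℝ
  bump : NI → Fin d → ℝ
  conceptName : NC → Set (Fin d → ℝ)
  headName : NR → Set (Fin d → ℝ)
  tailName : NR → Set (Fin d → ℝ)
  bumpBoxName : NR → Set (Fin d → ℝ)
  pos_mem : ∀ a, pos a ∈ universeBox d s
  bump_mem : ∀ a, bump a ∈ universeBox d s
  conceptName_isBox : ∀ A, IsBox ε s (conceptName A)
  headName_isBox : ∀ R, IsBox ε s (headName R)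
  tailName_isBox : ∀ R, IsBox ε s (tailName R)
  bumpBoxName_isBox : ∀ R, IsBox ε s (bumpBoxName R)

namespace BoxInterp

variable {NC NR NI : Type*} {d : ℕ} {ε s : ℝ} (η : BoxInterp NC NR NI d ε s)

/-- Head box of a role; inversion swaps head and tail. -/
def head : Role NR → Set (Fin d → ℝ)
  | .name R => η.headName R
  | .inv R => η.tailName R

/-- Tail box of a role; inversion swaps head and tail. -/
def tail : Role NR → Set (Fin d → ℝ)
  | .name R => η.tailName R
  | .inv R => η.headName R

/-- Bump box of a role; inversion does not change it. -/
def bumpBox : Role NR → Set (Fin d → ℝ)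
  | .name R => η.bumpBoxName R
  | .inv R => η.bumpBoxName R

/-- `η(A)`, and `η(∃S) = {x | L^H - U^B + ε ≤ x ≤ U^H - L^B - ε}`. -/
noncomputable def basic : BasicConcept NC NR → Set (Fin d → ℝ)
  | .atom A => η.conceptName A
  | .ex S =>
      boxSet ε (fun i => lowerBd ε (η.head S) i - upperBd ε (η.bumpBox S) i)
        (fun i => upperBd ε (η.head S) i - lowerBd ε (η.bumpBox S) i)

noncomputable def concept : GenConcept NC NR → Set (Fin d → ℝ)
  | .pos B => η.basic B
  | .neg B => complBox ε s (η.basic B)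

/-- `η ⊨ α`. -/
def Sat : Formula NC NR NI → Prop
  | .incl (.role S T) =>
      η.head S ⊆ η.head T ∧ η.tail S ⊆ η.tail T ∧ η.bumpBox S ⊆ η.bumpBox T
  | .incl (.concept B C) => η.basic B ⊆ η.concept C
  | .assn (.concept D a) => η.pos a ∈ η.basic D
  | .assn (.role R a b) =>
      η.pos a + η.bump b ∈ η.headName R ∧ η.pos b + η.bump a ∈ η.tailName R ∧
        η.bump a ∈ η.bumpBoxName R ∧ η.bump b ∈ η.bumpBoxName R

/-- (Weakly) KB faithful: every satisfied axiom is consistent with `K`. -/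
def KBFaithful (K : KB NC NR NI) : Prop := ∀ α, η.Sat α → K.ConsistentWith α

/-- KB entailed: every axiom entailed by `K` is satisfied. -/
def KBEntailed (K : KB NC NR NI) : Prop := ∀ α, K.Entails α → η.Sat α

/-- KB faithful model: both KB faithful and KB entailed. -/
def IsKBFaithfulModel (K : KB NC NR NI) : Prop := η.KBFaithful K ∧ η.KBEntailed K

end BoxInterp

end DLLite

namespace DLLite

open scoped Classical

/-! ### Basic concepts form a finite type -/

/-! Set all bumps to zero, so that a role matters only through `∃S` and `∃S⁻`, and use one
coordinate per basic concept `X`. A satisfiable `B` gets lower bound `-s/2` everywhere and, at `X`,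
upper bound `s/2 - 2ε` if `B` is disjoint from `X`, `s/2 + 2ε` if `X ⊑ B`, and `s/2` otherwise.
Comparing upper bounds at the coordinate of `B` decides `B ⊑ C` (`sub_of_upper_le`). Since `¬C`
reflects upper bounds `U` to `s - U`, `B ⊑ ¬C` holds in the boxes iff upper bounds add up to at most
`s`, which is disjointness (`upper_add_le`, `disj_of_upper_add_le`). Thus exactly the entailed
concept inclusions hold.

The position of `a` is lowered only at those `X` that are disjoint from an entailed concept of `a`.
Hence `a` lies in the box of each entailed concept, and in no box of a concept disjoint from one
(`position_le_of_has`, `not_disj_of_position_le`).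

Role inclusions and assertions may hold without being entailed, and must then be consistent. This is
`exists_model`: disjointness is a binary constraint, so a pairwise non-disjoint set generates a
type, and all types together form a model in which each `P` is the full product of `∃P` and `∃P⁻`.
-/

def Role.flip {NR : Type*} : Role NR → Role NR
  | .name R => .inv R
  | .inv R => .name R

def BasicConcept.equivSum (NC NR : Type*) : BasicConcept NC NR ≃ NC ⊕ (NR ⊕ NR) where
  toFun
    | .atom A => .inl A
    | .ex (.name R) => .inr (.inl R)
    | .ex (.inv R) => .inr (.inr R)
  invFun
    | .inl A => .atom A
    | .inr (.inl R) => .ex (.name R)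
    | .inr (.inr R) => .ex (.inv R)
  left_inv := by rintro (A | (R | R)) <;> rfl
  right_inv := by rintro (A | (R | R)) <;> rfl

instance {NC NR : Type*} [Finite NC] [Finite NR] : Finite (BasicConcept NC NR) :=
  Finite.of_equiv _ (BasicConcept.equivSum NC NR).symm

/-- Every dimension of at least `|N_C| + 2 |N_R|` can be labelled by all basic concepts. -/
theorem BasicConcept.exists_surjective {NC NR : Type*} [Fintype NC] [Fintype NR] [Nonempty NC]
    {d : ℕ} (hd : Fintype.card NC + 2 * Fintype.card NR ≤ d) :
    ∃ π : Fin d → BasicConcept NC NR, Function.Surjective π := by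
  have e := BasicConcept.equivSum NC NR
  have : Nonempty (NC ⊕ (NR ⊕ NR)) := ⟨.inl (Classical.arbitrary NC)⟩
  obtain ⟨f⟩ : Nonempty (NC ⊕ (NR ⊕ NR) ↪ Fin d) :=
    Function.Embedding.nonempty_of_card_le (by simp; omega)
  exact ⟨e.symm ∘ Function.invFun f, e.symm.surjective.comp (Function.invFun_surjective f.injective)⟩

theorem Interp.mem_role_flip {NC NR NI : Type*} (I : Interp NC NR NI) (S : Role NR) (x y : I.Dom) :
    (x, y) ∈ I.role S.flip ↔ (y, x) ∈ I.role S := by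
  cases S <;> rfl

/-! ### Entailment between basic concepts -/

namespace KB

variable {NC NR NI : Type*} (K : KB NC NR NI)

/-- `K ⊨ B ⊑ B'`. -/
def Sub (B B' : BasicConcept NC NR) : Prop := K.Entails (.incl (.concept B (.pos B')))

/-- `K ⊨ B ⊑ ¬B'`. -/
def Disj (B B' : BasicConcept NC NR) : Prop := K.Entails (.incl (.concept B (.neg B')))

/-- `K ⊨ B(a)`. -/
def Has (a : NI) (B : BasicConcept NC NR) : Prop := K.Entails (.assn (.concept B a))

variable {K}

theorem Sub.refl (B : BasicConcept NC NR) : K.Sub B B := fun _ _ _ h => h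

theorem Sub.trans {B C D : BasicConcept NC NR} (h : K.Sub B C) (h' : K.Sub C D) : K.Sub B D :=
  fun I hI _ hx => h' I hI (h I hI hx)

theorem Disj.symm {B C : BasicConcept NC NR} (h : K.Disj B C) : K.Disj C B :=
  fun I hI _ hx hx' => h I hI hx' hx

theorem Disj.mono {B C B' C' : BasicConcept NC NR} (h : K.Disj B C) (hB : K.Sub B' B)
    (hC : K.Sub C' C) : K.Disj B' C' :=
  fun I hI _ hx hx' => h I hI (hB I hI hx) (hC I hI hx')

theorem Disj.of_self_left {B : BasicConcept NC NR} (h : K.Disj B B) (C : BasicConcept NC NR) :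
    K.Disj B C :=
  fun I hI _ hx => (h I hI hx hx).elim

theorem Sub.of_disj_self {B : BasicConcept NC NR} (h : K.Disj B B) (C : BasicConcept NC NR) :
    K.Sub B C :=
  fun I hI _ hx => (h I hI hx hx).elim

theorem Disj.flip {S : Role NR} (h : K.Disj (.ex S) (.ex S)) :
    K.Disj (.ex S.flip) (.ex S.flip) := by
  rintro I hI x ⟨y, hy⟩ -
  have hy' : y ∈ I.basic (.ex S) := ⟨x, (I.mem_role_flip S x y).1 hy⟩
  exact h I hI hy' hy'

theorem disj_flip_iff {S : Role NR} :
    K.Disj (.ex S.flip) (.ex S.flip) ↔ K.Disj (.ex S) (.ex S) :=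
  ⟨fun h => by simpa only [show S.flip.flip = S by cases S <;> rfl] using h.flip, Disj.flip⟩

theorem Has.not_disj (hK : K.Satisfiable) {a : NI} {B C : BasicConcept NC NR} (hB : K.Has a B)
    (hC : K.Has a C) : ¬ K.Disj B C := by
  obtain ⟨I, hI⟩ := hK
  exact fun h => h I hI (hB I hI) (hC I hI)

theorem Entails.sub_ex {S T : Role NR} (h : K.Entails (.incl (.role S T))) :
    K.Sub (.ex S) (.ex T) :=
  fun I hI _ ⟨y, hy⟩ => ⟨y, h I hI hy⟩

theorem Entails.sub_ex_flip {S T : Role NR} (h : K.Entails (.incl (.role S T))) :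
    K.Sub (.ex S.flip) (.ex T.flip) :=
  fun I hI x ⟨y, hy⟩ =>
    ⟨y, (I.mem_role_flip T x y).2 (h I hI ((I.mem_role_flip S x y).1 hy))⟩

theorem Entails.has_ex {R : NR} {a b : NI} (h : K.Entails (.assn (.role R a b))) :
    K.Has a (.ex (.name R)) :=
  fun I hI => ⟨_, h I hI⟩

theorem Entails.has_ex_inv {R : NR} {a b : NI} (h : K.Entails (.assn (.role R a b))) :
    K.Has b (.ex (.inv R)) :=
  fun I hI => ⟨_, h I hI⟩

theorem entails_of_mem {α : Formula NC NR NI} (h : K.Mem α) : K.Entails α := fun _ hI => hI α h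

theorem Entails.consistentWith (hK : K.Satisfiable) {α : Formula NC NR NI} (h : K.Entails α) :
    K.ConsistentWith α := by
  obtain ⟨I, hI⟩ := hK
  exact ⟨I, hI, h I hI⟩

/-! ### The model of types -/

variable (K)

/-- A type: a set of basic concepts closed under entailed inclusions, no two of its members
being entailed to be disjoint. -/
structure IsType (t : Set (BasicConcept NC NR)) : Prop where
  closed : ∀ B ∈ t, ∀ C, K.Sub B C → C ∈ t
  consistent : ∀ B ∈ t, ∀ C ∈ t, ¬ K.Disj B C

/-- The closure of a set of basic concepts under entailed inclusions. -/
def closure (G : Set (BasicConcept NC NR)) : Set (BasicConcept NC NR) := {C | ∃ B ∈ G, K.Sub B C}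

variable {K}

theorem subset_closure (G : Set (BasicConcept NC NR)) : G ⊆ K.closure G :=
  fun B hB => ⟨B, hB, Sub.refl B⟩

theorem isType_closure {G : Set (BasicConcept NC NR)} (hG : ∀ B ∈ G, ∀ C ∈ G, ¬ K.Disj B C) :
    K.IsType (K.closure G) where
  closed := fun _ ⟨B, hB, h⟩ _ h' => ⟨B, hB, h.trans h'⟩
  consistent := fun _ ⟨B, hB, h⟩ _ ⟨C, hC, h'⟩ hd => hG B hB C hC (hd.mono h h')

/-- The types of `K`, all realised at once; two types are related by `P` as soon as the first
contains `∃P` and the second `∃P⁻`. -/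
noncomputable def typeModel [Finite NC] [Finite NR] (K : KB NC NR NI)
    (τ : NI → {t : Set (BasicConcept NC NR) // K.IsType t}) : Interp NC NR NI where
  -- Domains must live in `Type`; there are only finitely many types, so they form a small set.
  Dom := Shrink.{0} {t : Set (BasicConcept NC NR) // K.IsType t}
  nonempty := ⟨equivShrink _ ⟨∅, by simp, by simp⟩⟩
  conceptName A := {x | .atom A ∈ ((equivShrink _).symm x).1}
  roleName R := {p | .ex (.name R) ∈ ((equivShrink _).symm p.1).1 ∧
    .ex (.inv R) ∈ ((equivShrink _).symm p.2).1}
  indiv a := equivShrink _ (τ a)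

section TypeModel

variable [Finite NC] [Finite NR] (τ : NI → {t : Set (BasicConcept NC NR) // K.IsType t})

theorem mem_role_typeModel (S : Role NR) (x y : (K.typeModel τ).Dom) :
    (x, y) ∈ (K.typeModel τ).role S ↔
      .ex S ∈ ((equivShrink _).symm x).1 ∧ .ex S.flip ∈ ((equivShrink _).symm y).1 := by
  cases S
  · rfl
  · exact and_comm

theorem mem_basic_typeModel (B : BasicConcept NC NR) (x : (K.typeModel τ).Dom) :
    x ∈ (K.typeModel τ).basic B ↔ B ∈ ((equivShrink _).symm x).1 := by
  cases B with
  | atom A => rfl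
  | ex S =>
    constructor
    · rintro ⟨y, hy⟩
      exact ((mem_role_typeModel τ S x y).1 hy).1
    · intro hx
      -- A role and its inverse are empty together, so `∃S⁻` is satisfiable and generates a type,
      -- which serves as the successor.
      have hS : ¬ K.Disj (.ex S.flip) (.ex S.flip) := fun h =>
        ((equivShrink _).symm x).2.consistent _ hx _ hx (disj_flip_iff.1 h)
      have ht : K.IsType (K.closure {.ex S.flip}) :=
        isType_closure (by rintro _ rfl _ rfl; exact hS)
      refine ⟨equivShrink _ ⟨_, ht⟩, (mem_role_typeModel τ S _ _).2 ⟨hx, ?_⟩⟩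
      rw [Equiv.symm_apply_apply]
      exact subset_closure _ rfl

theorem symm_indiv_typeModel (a : NI) :
    (equivShrink _).symm ((K.typeModel τ).indiv a) = τ a :=
  Equiv.symm_apply_apply _ _

theorem indiv_mem_basic_typeModel (B : BasicConcept NC NR) (a : NI) :
    (K.typeModel τ).indiv a ∈ (K.typeModel τ).basic B ↔ B ∈ (τ a).1 := by
  rw [mem_basic_typeModel, symm_indiv_typeModel]

theorem indiv_mem_roleName_typeModel (R : NR) (a b : NI) :
    ((K.typeModel τ).indiv a, (K.typeModel τ).indiv b) ∈ (K.typeModel τ).roleName R ↔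
      .ex (.name R) ∈ (τ a).1 ∧ .ex (.inv R) ∈ (τ b).1 := by
  refine (mem_role_typeModel τ (.name R) _ _).trans ?_
  rw [symm_indiv_typeModel, symm_indiv_typeModel]
  rfl

/-- Roles are full products here, so inclusion of both factors suffices, even if `S ⊑ T` is not
entailed. -/
theorem role_subset_typeModel {S T : Role NR} (h : K.Sub (.ex S) (.ex T))
    (h' : K.Sub (.ex S.flip) (.ex T.flip)) :
    (K.typeModel τ).role S ⊆ (K.typeModel τ).role T := by
  rintro ⟨x, y⟩ hxy
  rw [mem_role_typeModel] at hxy ⊢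
  exact ⟨((equivShrink _).symm x).2.closed _ hxy.1 _ h,
    ((equivShrink _).symm y).2.closed _ hxy.2 _ h'⟩

theorem typeModel_models (hτ : ∀ a B, K.Has a B → B ∈ (τ a).1) : (K.typeModel τ).Models K := by
  intro α hα
  have hE := entails_of_mem hα
  match α with
  | .incl (.role S T) => exact role_subset_typeModel τ hE.sub_ex hE.sub_ex_flip
  | .incl (.concept B (.pos C)) =>
    intro x hx
    refine (mem_basic_typeModel τ C x).2 ?_
    rw [mem_basic_typeModel] at hx
    exact ((equivShrink _).symm x).2.closed _ hx _ hE
  | .incl (.concept B (.neg C)) =>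
    intro x hx hx'
    rw [mem_basic_typeModel] at hx hx'
    exact ((equivShrink _).symm x).2.consistent _ hx _ hx' hE
  | .assn (.concept B a) => exact (indiv_mem_basic_typeModel τ B a).2 (hτ a B hE)
  | .assn (.role R a b) =>
    exact (indiv_mem_roleName_typeModel τ R a b).2 ⟨hτ a _ hE.has_ex, hτ b _ hE.has_ex_inv⟩

end TypeModel

/-- The generators `G` of the types of the individuals can be realised in a model of `K`. -/
theorem exists_model [Finite NC] [Finite NR] (G : NI → Set (BasicConcept NC NR))
    (hG : ∀ a B, K.Has a B → B ∈ G a) (hd : ∀ a, ∀ B ∈ G a, ∀ C ∈ G a, ¬ K.Disj B C) :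
    ∃ I : Interp NC NR NI, I.Models K ∧ (∀ a, ∀ B ∈ G a, I.indiv a ∈ I.basic B) ∧
      (∀ R a b, .ex (.name R) ∈ G a → .ex (.inv R) ∈ G b →
        (I.indiv a, I.indiv b) ∈ I.roleName R) ∧
      ∀ S T, K.Sub (.ex S) (.ex T) → K.Sub (.ex S.flip) (.ex T.flip) → I.role S ⊆ I.role T := by
  let τ : NI → {t : Set (BasicConcept NC NR) // K.IsType t} := fun a =>
    ⟨K.closure (G a), isType_closure (hd a)⟩
  refine ⟨K.typeModel τ, typeModel_models τ fun a B h => subset_closure _ (hG a B h),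
    fun a B h => (indiv_mem_basic_typeModel τ B a).2 (subset_closure _ h),
    fun R a b h h' => (indiv_mem_roleName_typeModel τ R a b).2
      ⟨subset_closure _ h, subset_closure _ h'⟩, fun S T => role_subset_typeModel τ⟩

/-! ### Criteria for consistency with the knowledge base -/

theorem consistentWith_role_incl [Finite NC] [Finite NR] (hK : K.Satisfiable) {S T : Role NR}
    (h : K.Sub (.ex S) (.ex T)) (h' : K.Sub (.ex S.flip) (.ex T.flip)) :
    K.ConsistentWith (.incl (.role S T)) := by
  obtain ⟨I, hI, -, -, hr⟩ := exists_model (K := K) (fun a => {B | K.Has a B}) (fun _ _ h => h)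
    fun _ _ hB _ hC => Has.not_disj hK hB hC
  exact ⟨I, hI, hr S T h h'⟩

theorem exists_model_of_extra [Finite NC] [Finite NR] (hK : K.Satisfiable)
    (X : NI → Set (BasicConcept NC NR)) (hX : ∀ a, ∀ B ∈ X a, ∀ C ∈ X a, ¬ K.Disj B C)
    (hH : ∀ a, ∀ B ∈ X a, ∀ C, K.Has a C → ¬ K.Disj B C) :
    ∃ I : Interp NC NR NI, I.Models K ∧ (∀ a, ∀ B ∈ X a, I.indiv a ∈ I.basic B) ∧
      ∀ R a b, .ex (.name R) ∈ X a → .ex (.inv R) ∈ X b →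
        (I.indiv a, I.indiv b) ∈ I.roleName R := by
  obtain ⟨I, hI, hB, hr, -⟩ := exists_model (K := K) (fun a => {B | K.Has a B} ∪ X a)
    (fun _ _ h => .inl h) (by
      rintro a B (hB | hB) C (hC | hC)
      · exact Has.not_disj hK hB hC
      · exact fun h => hH a C hC B hB h.symm
      · exact hH a B hB C hC
      · exact hX a B hB C hC)
  exact ⟨I, hI, fun a B h => hB a B (.inr h), fun R a b h h' => hr R a b (.inr h) (.inr h')⟩

theorem consistentWith_concept [Finite NC] [Finite NR] (hK : K.Satisfiable)
    {B : BasicConcept NC NR} {a : NI} (hB : ¬ K.Disj B B)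
    (h : ∀ C, K.Has a C → ¬ K.Disj B C) : K.ConsistentWith (.assn (.concept B a)) := by
  obtain ⟨I, hI, hm, -⟩ := exists_model_of_extra hK (fun c => {C | c = a ∧ C = B})
    (by rintro _ _ ⟨rfl, rfl⟩ _ ⟨-, rfl⟩; exact hB) (by rintro _ _ ⟨rfl, rfl⟩; exact h)
  exact ⟨I, hI, hm a B ⟨rfl, rfl⟩⟩

theorem consistentWith_role [Finite NC] [Finite NR] (hK : K.Satisfiable)
    {R : NR} {a b : NI} (hR : ¬ K.Disj (.ex (.name R)) (.ex (.name R)))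
    (ha : ∀ C, K.Has a C → ¬ K.Disj (.ex (.name R)) C)
    (hb : ∀ C, K.Has b C → ¬ K.Disj (.ex (.inv R)) C)
    (hab : a = b → ¬ K.Disj (.ex (.name R)) (.ex (.inv R))) :
    K.ConsistentWith (.assn (.role R a b)) := by
  have hR' : ¬ K.Disj (.ex (.inv R)) (.ex (.inv R)) := fun h =>
    hR (disj_flip_iff (S := .name R).1 h)
  obtain ⟨I, hI, -, hm⟩ := exists_model_of_extra hK
    (fun c => {C | (c = a ∧ C = .ex (.name R)) ∨ (c = b ∧ C = .ex (.inv R))})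
    (by
      rintro _ _ (⟨rfl, rfl⟩ | ⟨rfl, rfl⟩) _ (⟨h, rfl⟩ | ⟨h, rfl⟩)
      · exact hR
      · exact hab h
      · exact fun hd => hab h.symm hd.symm
      · exact hR')
    (by
      rintro _ _ (⟨rfl, rfl⟩ | ⟨rfl, rfl⟩)
      · exact ha
      · exact hb)
  exact ⟨I, hI, hm R a b (.inl ⟨rfl, rfl⟩) (.inr ⟨rfl, rfl⟩)⟩

/-! ### Bounds of the boxes -/

variable (K)

/-- The upper bound of the box of `B` in the coordinate that belongs to `X`: concepts disjoint
from `X` are low, those subsuming `X` are high. -/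
noncomputable def upper (ε s : ℝ) (B X : BasicConcept NC NR) : ℝ :=
  if K.Disj B X then s / 2 - 2 * ε else if K.Sub X B then s / 2 + 2 * ε else s / 2

/-- The position of `a` in the coordinate that belongs to `X`. -/
noncomputable def position (ε s : ℝ) (a : NI) (X : BasicConcept NC NR) : ℝ :=
  if ∃ B, K.Has a B ∧ K.Disj B X then s / 2 - 4 * ε else s / 2 - 2 * ε

variable {K} {ε s : ℝ}

theorem le_upper (hε : 0 < ε) (B X : BasicConcept NC NR) : s / 2 - 2 * ε ≤ K.upper ε s B X := by
  unfold upper; split_ifs <;> linarith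

theorem upper_le (hε : 0 < ε) (B X : BasicConcept NC NR) : K.upper ε s B X ≤ s / 2 + 2 * ε := by
  unfold upper; split_ifs <;> linarith

theorem upper_self {X : BasicConcept NC NR} (hX : ¬ K.Disj X X) :
    K.upper ε s X X = s / 2 + 2 * ε := by
  rw [upper, if_neg hX, if_pos (Sub.refl X)]

theorem upper_mono (hε : 0 < ε) {B C : BasicConcept NC NR} (h : K.Sub B C)
    (X : BasicConcept NC NR) : K.upper ε s B X ≤ K.upper ε s C X := by
  by_cases hC : K.Disj C X
  · rw [upper, if_pos (hC.mono h (Sub.refl X)), upper, if_pos hC]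
  · by_cases hX : K.Sub X B
    · rw [upper.eq_def K ε s C, if_neg hC, if_pos (hX.trans h)]
      exact upper_le hε B X
    · unfold upper
      split_ifs <;> linarith

/-- If one of the two is high at `X`, it subsumes `X`, so the other is disjoint from `X` and low;
otherwise neither exceeds `s/2`. -/
theorem upper_add_le (hε : 0 < ε) {B C : BasicConcept NC NR} (h : K.Disj B C)
    (X : BasicConcept NC NR) : K.upper ε s B X + K.upper ε s C X ≤ s := by
  by_cases hB : K.Sub X B
  · have := upper_le (K := K) (s := s) hε B X
    rw [upper.eq_def K ε s C, if_pos (h.mono hB (Sub.refl C)).symm]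
    linarith
  · by_cases hC : K.Sub X C
    · have := upper_le (K := K) (s := s) hε C X
      rw [upper.eq_def K ε s B, if_pos (h.mono (Sub.refl B) hC)]
      linarith
    · unfold upper
      split_ifs <;> linarith

theorem sub_of_upper_le (hε : 0 < ε) {X C : BasicConcept NC NR} (hX : ¬ K.Disj X X)
    (h : K.upper ε s X X ≤ K.upper ε s C X) : K.Sub X C := by
  rw [upper_self hX] at h
  by_contra hC
  unfold upper at h
  split_ifs at h <;> linarith

theorem disj_of_upper_add_le (hε : 0 < ε) {X C : BasicConcept NC NR} (hX : ¬ K.Disj X X)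
    (h : K.upper ε s X X + K.upper ε s C X ≤ s) : K.Disj X C := by
  rw [upper_self hX] at h
  by_contra hC
  rw [upper, if_neg fun h => hC h.symm] at h
  split_ifs at h <;> linarith

/-- One `ε` of the margin is the one built into `boxSet`, the other pays for the shrinking of head
and tail boxes. -/
theorem position_le_of_has (hε : 0 < ε) {a : NI} {B : BasicConcept NC NR} (h : K.Has a B)
    (X : BasicConcept NC NR) : K.position ε s a X ≤ K.upper ε s B X - 2 * ε := by
  by_cases hX : K.Disj B X
  · rw [position, if_pos ⟨B, h, hX⟩, upper, if_pos hX]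
    linarith
  · unfold position upper
    split_ifs <;> linarith

theorem le_position (hε : 0 < ε) (a : NI) (X : BasicConcept NC NR) :
    s / 2 - 4 * ε ≤ K.position ε s a X := by
  unfold position; split_ifs <;> linarith

theorem position_le (hε : 0 < ε) (a : NI) (X : BasicConcept NC NR) :
    K.position ε s a X ≤ s / 2 - 2 * ε := by
  unfold position; split_ifs <;> linarith

theorem exists_has_of_position_le (hε : 0 < ε) {a : NI} {B X : BasicConcept NC NR}
    (h : K.position ε s a X ≤ K.upper ε s B X - ε) (hB : K.Disj B X) :
    ∃ C, K.Has a C ∧ K.Disj C X := by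
  by_contra hC
  rw [position, if_neg hC, upper, if_pos hB] at h
  linarith

theorem not_disj_of_position_le (hK : K.Satisfiable) (hε : 0 < ε) {a : NI}
    {B : BasicConcept NC NR} (h : ∀ X, K.position ε s a X ≤ K.upper ε s B X - ε)
    (C : BasicConcept NC NR) (hC : K.Has a C) : ¬ K.Disj B C := by
  intro hBC
  -- At the coordinate of `C` the box of `B` is low, so `a` must have been lowered there by some
  -- entailed `D` disjoint from `C`.
  obtain ⟨D, hD, hDC⟩ := exists_has_of_position_le hε (h C) hBC
  exact Has.not_disj hK hD hC hDC

end KB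

/-! ### The box interpretation -/

theorem boxSet_nonempty {d : ℕ} {ε : ℝ} {L U : Fin d → ℝ} (h : ∀ i, L i + ε ≤ U i - ε) :
    (boxSet ε L U).Nonempty :=
  ⟨fun i => L i + ε, fun i => ⟨le_rfl, h i⟩⟩

theorem boxSet_subset_boxSet_iff {d : ℕ} {ε : ℝ} {L U L' U' : Fin d → ℝ}
    (h : ∀ i, L i + ε ≤ U i - ε) :
    boxSet ε L U ⊆ boxSet ε L' U' ↔ ∀ i, L' i ≤ L i ∧ U i ≤ U' i := by
  constructor
  · intro hs i
    have h₁ := (hs (show (fun i => L i + ε) ∈ _ from fun j => ⟨le_rfl, h j⟩) i).1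
    have h₂ := (hs (show (fun i => U i - ε) ∈ _ from fun j => ⟨h j, le_rfl⟩) i).2
    constructor <;> linarith
  · intro hs x hx i
    have := hs i
    have := hx i
    constructor <;> linarith

/-- The coordinate `i` is essential: in dimension `0` no box is empty. -/
theorem boxSet_eq_empty {d : ℕ} {ε : ℝ} (hε : 0 < ε) (i : Fin d) {L U : Fin d → ℝ}
    (h : U i ≤ L i) : boxSet ε L U = ∅ := by
  refine Set.eq_empty_of_forall_notMem fun x hx => ?_
  have := hx i
  linarith

theorem isBox_empty {d : ℕ} {ε s : ℝ} (hε : 0 < ε) (hs : 0 ≤ s) (i : Fin d) :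
    IsBox ε s (∅ : Set (Fin d → ℝ)) :=
  ⟨0, 0, fun _ => by simpa using hs, (boxSet_eq_empty hε i le_rfl).symm⟩

section

variable {NC NR NI : Type*} {d : ℕ} (K : KB NC NR NI) (ε s : ℝ) (π : Fin d → BasicConcept NC NR)

/-- The box `[-s/2, upper]`, shrunk by `c` on both sides; empty for unsatisfiable `B`. -/
noncomputable def conceptBox (c : ℝ) (B : BasicConcept NC NR) : Set (Fin d → ℝ) :=
  if K.Disj B B then ∅ else
    boxSet ε (fun _ => -(s / 2) + c) (fun i => K.upper ε s B (π i) - c)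

/-- The box `{0}`, or the empty box for a role that is unsatisfiable. -/
noncomputable def zeroBox (S : Role NR) : Set (Fin d → ℝ) :=
  if K.Disj (.ex S) (.ex S) then ∅ else boxSet ε (fun _ => -ε) (fun _ => ε)

variable {K ε s π}

theorem conceptBox_isBox (hε : 0 < ε) (hs : ε ≤ s / 8) (i : Fin d) {c : ℝ} (hc : 0 ≤ c)
    (hc' : c ≤ ε) (B : BasicConcept NC NR) : IsBox ε s (conceptBox K ε s π c B) := by
  unfold conceptBox
  split_ifs
  · exact isBox_empty hε (by linarith) i
  · refine ⟨_, _, fun j => ?_, rfl⟩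
    have := KB.le_upper (K := K) (s := s) hε B (π j)
    have := KB.upper_le (K := K) (s := s) hε B (π j)
    constructor <;> linarith

theorem zeroBox_isBox (hε : 0 < ε) (hs : ε ≤ s / 8) (i : Fin d) (S : Role NR) :
    IsBox ε s (zeroBox (d := d) K ε S) := by
  unfold zeroBox
  split_ifs
  · exact isBox_empty hε (by linarith) i
  · refine ⟨_, _, fun j => ?_, rfl⟩
    constructor <;> linarith

theorem conceptBox_bounds (hε : 0 < ε) (hs : ε ≤ s / 8) {c : ℝ} (hc' : c ≤ ε)
    (B : BasicConcept NC NR) (i : Fin d) :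
    (-(s / 2) + c) + ε ≤ (K.upper ε s B (π i) - c) - ε := by
  have := KB.le_upper (K := K) (s := s) hε B (π i)
  linarith

theorem conceptBox_mono (hε : 0 < ε) (c : ℝ) {B C : BasicConcept NC NR} (h : K.Sub B C) :
    conceptBox K ε s π c B ⊆ conceptBox K ε s π c C := by
  unfold conceptBox
  split_ifs with hB hC hC
  · exact Set.Subset.rfl
  · exact Set.empty_subset _
  · exact (hB (hC.mono h h)).elim
  · intro x hx i
    have := hx i
    have := KB.upper_mono (s := s) hε h (π i)
    constructor <;> linarith

theorem sub_of_conceptBox_subset (hε : 0 < ε) (hs : ε ≤ s / 8) (hπ : Function.Surjective π)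
    {c : ℝ} (hc' : c ≤ ε) {B C : BasicConcept NC NR}
    (h : conceptBox K ε s π c B ⊆ conceptBox K ε s π c C) : K.Sub B C := by
  by_cases hB : K.Disj B B
  · exact KB.Sub.of_disj_self hB C
  unfold conceptBox at h
  rw [if_neg hB] at h
  split_ifs at h with hC
  · exact ((boxSet_nonempty (conceptBox_bounds hε hs hc' B)).ne_empty
      (Set.subset_empty_iff.1 h)).elim
  · obtain ⟨i, rfl⟩ := hπ B
    have := ((boxSet_subset_boxSet_iff (conceptBox_bounds hε hs hc' _)).1 h i).2
    exact KB.sub_of_upper_le hε hB (by linarith)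

theorem conceptBox_subset_complBox_iff (hε : 0 < ε) (hs : ε ≤ s / 8)
    (hπ : Function.Surjective π) {B C : BasicConcept NC NR} :
    conceptBox K ε s π 0 B ⊆ complBox ε s (conceptBox K ε s π 0 C) ↔ K.Disj B C := by
  by_cases hB : K.Disj B B
  · simp only [conceptBox, if_pos hB, Set.empty_subset, hB.of_self_left C]
  by_cases hC : K.Disj C C
  · refine iff_of_true ?_ (hC.of_self_left B).symm
    rw [conceptBox, conceptBox, if_neg hB, if_pos hC, complBox,
      boxSet_subset_boxSet_iff (conceptBox_bounds hε hs hε.le B)]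
    intro i
    have := KB.upper_le (K := K) (s := s) hε B (π i)
    -- The empty box has bounds `0`, so its complement has bounds `-s` and `s`, which enclose the
    -- box of `B`.
    simp only [lowerBd, upperBd, Set.not_nonempty_empty, if_false, Pi.zero_apply]
    constructor <;> linarith
  · have hne := boxSet_nonempty (conceptBox_bounds (K := K) (π := π) hε hs hε.le C)
    rw [conceptBox, conceptBox, if_neg hB, if_neg hC, complBox, lowerBd_boxSet hne,
      upperBd_boxSet hne, boxSet_subset_boxSet_iff (conceptBox_bounds hε hs hε.le B)]
    constructor
    · intro h
      obtain ⟨i, rfl⟩ := hπ B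
      have := (h i).2
      dsimp only at this
      exact KB.disj_of_upper_add_le (s := s) hε hB (by linarith)
    · intro h i
      have := KB.upper_add_le (s := s) hε h (π i)
      constructor <;> linarith

theorem zeroBox_mono {S T : Role NR} (h : K.Sub (.ex S) (.ex T)) :
    zeroBox (d := d) K ε S ⊆ zeroBox K ε T := by
  unfold zeroBox
  split_ifs with hS hT hT
  · exact Set.Subset.rfl
  · exact Set.empty_subset _
  · exact (hS (hT.mono h h)).elim
  · exact Set.Subset.rfl

theorem position_mem_conceptBox (hK : K.Satisfiable) (hε : 0 < ε) (hs : ε ≤ s / 8) {c : ℝ}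
    (hc' : c ≤ ε) {a : NI} {B : BasicConcept NC NR} (h : K.Has a B) :
    (fun i => K.position ε s a (π i)) ∈ conceptBox K ε s π c B := by
  rw [conceptBox, if_neg (KB.Has.not_disj hK h h)]
  intro i
  have := KB.position_le_of_has (s := s) hε h (π i)
  have := KB.le_position (K := K) (s := s) hε a (π i)
  constructor <;> linarith

theorem of_position_mem_conceptBox (hπ : Function.Surjective π) {c : ℝ} (hc : 0 ≤ c) {a : NI}
    {B : BasicConcept NC NR} (h : (fun i => K.position ε s a (π i)) ∈ conceptBox K ε s π c B) :
    ¬ K.Disj B B ∧ ∀ X, K.position ε s a X ≤ K.upper ε s B X - ε := by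
  unfold conceptBox at h
  split_ifs at h with hB
  · exact h.elim
  · refine ⟨hB, fun X => ?_⟩
    obtain ⟨i, rfl⟩ := hπ X
    have := (h i).2
    linarith

variable (K π) in
/-- The box interpretation with one kind of coordinate for each basic concept. -/
noncomputable def boxModel (hε : 0 < ε) (hs : ε ≤ s / 8) (i₀ : Fin d) :
    BoxInterp NC NR NI d ε s where
  pos a i := K.position ε s a (π i)
  bump _ _ := 0
  conceptName A := conceptBox K ε s π 0 (.atom A)
  -- The shrinking by `ε` cancels the bounds `∓ε` of the bump box `{0}` in the formula for `∃S`.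
  headName R := conceptBox K ε s π ε (.ex (.name R))
  tailName R := conceptBox K ε s π ε (.ex (.inv R))
  bumpBoxName R := zeroBox K ε (.name R)
  pos_mem a i := by
    have := KB.le_position (K := K) (s := s) hε a (π i)
    have := KB.position_le (K := K) (s := s) hε a (π i)
    constructor <;> linarith
  bump_mem _ _ := by constructor <;> linarith
  conceptName_isBox _ := conceptBox_isBox hε hs i₀ le_rfl hε.le _
  headName_isBox _ := conceptBox_isBox hε hs i₀ hε.le le_rfl _
  tailName_isBox _ := conceptBox_isBox hε hs i₀ hε.le le_rfl _
  bumpBoxName_isBox _ := zeroBox_isBox hε hs i₀ _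

/-! ### Satisfaction of axioms in the box interpretation -/

section BoxModel

variable (hε : 0 < ε) (hs : ε ≤ s / 8) (i₀ : Fin d)

theorem boxModel_head (S : Role NR) :
    (boxModel K π hε hs i₀).head S = conceptBox K ε s π ε (.ex S) := by
  cases S <;> rfl

theorem boxModel_tail (S : Role NR) :
    (boxModel K π hε hs i₀).tail S = conceptBox K ε s π ε (.ex S.flip) := by
  cases S <;> rfl

theorem boxModel_bumpBox (S : Role NR) :
    (boxModel K π hε hs i₀).bumpBox S = zeroBox K ε S := by
  cases S with
  | name R => rfl
  | inv R =>
    have := KB.disj_flip_iff (K := K) (S := .name R)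
    simp only [Role.flip] at this
    simp only [BoxInterp.bumpBox, boxModel, zeroBox, this]

theorem boxModel_basic (B : BasicConcept NC NR) :
    (boxModel K π hε hs i₀).basic B = conceptBox K ε s π 0 B := by
  cases B with
  | atom A => rfl
  | ex S =>
    rw [BoxInterp.basic, boxModel_head, boxModel_bumpBox]
    unfold conceptBox zeroBox
    split_ifs with hS
    -- Head and bump box are both empty, with bounds `0`. A bump box `{0}` would instead give `∃S`
    -- the bounds `-ε` and `ε`, hence the non-empty box `{0}`.
    · refine boxSet_eq_empty hε i₀ ?_
      simp [lowerBd, upperBd]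
    · have h₁ := boxSet_nonempty (conceptBox_bounds (K := K) (π := π) hε hs le_rfl (.ex S))
      have h₂ : (boxSet (d := d) ε (fun _ => -ε) (fun _ => ε)).Nonempty :=
        boxSet_nonempty fun _ => by linarith
      rw [lowerBd_boxSet h₁, upperBd_boxSet h₁, lowerBd_boxSet h₂, upperBd_boxSet h₂]
      congr 1 <;> funext i <;> ring

theorem boxModel_sat_role {R : NR} {a b : NI} :
    (boxModel K π hε hs i₀).Sat (.assn (.role R a b)) ↔
      (fun i => K.position ε s a (π i)) ∈ conceptBox K ε s π ε (.ex (.name R)) ∧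
      (fun i => K.position ε s b (π i)) ∈ conceptBox K ε s π ε (.ex (.inv R)) ∧
      ¬ K.Disj (.ex (.name R)) (.ex (.name R)) := by
  have h0 : (fun _ => 0 : Fin d → ℝ) ∈ zeroBox K ε (.name R) ↔
      ¬ K.Disj (.ex (.name R)) (.ex (.name R)) := by
    unfold zeroBox
    split_ifs with h
    · simp [h]
    · simp [h, boxSet]
  have hadd : ∀ x : Fin d → ℝ, x + (fun _ => 0) = x := fun x => add_zero x
  simp only [BoxInterp.Sat, boxModel, h0, hadd, and_self]

theorem boxModel_kbEntailed (hK : K.Satisfiable) (hπ : Function.Surjective π) :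
    (boxModel K π hε hs i₀).KBEntailed K := by
  intro α hα
  match α with
  | .incl (.role S T) =>
    simp only [BoxInterp.Sat, boxModel_head, boxModel_tail, boxModel_bumpBox]
    exact ⟨conceptBox_mono hε ε hα.sub_ex, conceptBox_mono hε ε hα.sub_ex_flip,
      zeroBox_mono hα.sub_ex⟩
  | .incl (.concept B (.pos C)) =>
    simp only [BoxInterp.Sat, BoxInterp.concept, boxModel_basic]
    exact conceptBox_mono hε 0 hα
  | .incl (.concept B (.neg C)) =>
    simp only [BoxInterp.Sat, BoxInterp.concept, boxModel_basic]
    exact (conceptBox_subset_complBox_iff hε hs hπ).2 hα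
  | .assn (.concept B a) =>
    simp only [BoxInterp.Sat, boxModel_basic]
    exact position_mem_conceptBox hK hε hs hε.le hα
  | .assn (.role R a b) =>
    exact (boxModel_sat_role hε hs i₀).2 ⟨position_mem_conceptBox hK hε hs le_rfl hα.has_ex,
      position_mem_conceptBox hK hε hs le_rfl hα.has_ex_inv,
      KB.Has.not_disj hK hα.has_ex hα.has_ex⟩

theorem boxModel_kbFaithful [Finite NC] [Finite NR] (hK : K.Satisfiable)
    (hπ : Function.Surjective π) : (boxModel K π hε hs i₀).KBFaithful K := by
  intro α hα
  match α with
  | .incl (.role S T) =>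
    simp only [BoxInterp.Sat, boxModel_head, boxModel_tail] at hα
    exact KB.consistentWith_role_incl hK (sub_of_conceptBox_subset hε hs hπ le_rfl hα.1)
      (sub_of_conceptBox_subset hε hs hπ le_rfl hα.2.1)
  | .incl (.concept B (.pos C)) =>
    simp only [BoxInterp.Sat, BoxInterp.concept, boxModel_basic] at hα
    exact KB.Entails.consistentWith hK (sub_of_conceptBox_subset hε hs hπ hε.le hα)
  | .incl (.concept B (.neg C)) =>
    simp only [BoxInterp.Sat, BoxInterp.concept, boxModel_basic] at hα
    exact KB.Entails.consistentWith hK ((conceptBox_subset_complBox_iff hε hs hπ).1 hα)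
  | .assn (.concept B a) =>
    simp only [BoxInterp.Sat, boxModel_basic] at hα
    obtain ⟨hB, hp⟩ := of_position_mem_conceptBox hπ le_rfl hα
    exact KB.consistentWith_concept hK hB (KB.not_disj_of_position_le hK hε hp)
  | .assn (.role R a b) =>
    obtain ⟨ha, hb, hR⟩ := (boxModel_sat_role hε hs i₀).1 hα
    have ha' := KB.not_disj_of_position_le hK hε (of_position_mem_conceptBox hπ hε.le ha).2
    have hb' := (of_position_mem_conceptBox hπ hε.le hb).2
    refine KB.consistentWith_role hK hR ha' (KB.not_disj_of_position_le hK hε hb') ?_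
    -- For a loop `R(a, a)`, disjointness of `∃R` and `∃R⁻` makes the box of `∃R⁻` low at the
    -- coordinate of `∃R`. So `a` has an entailed concept disjoint from `∃R`, against membership in
    -- the head box.
    rintro rfl hd
    obtain ⟨C, hC, hCR⟩ := KB.exists_has_of_position_le hε (hb' _) hd.symm
    exact ha' C hC hCR.symm

end BoxModel

end

end DLLite

theorem corollary2 {NC NR NI : Type*} [Fintype NC] [Fintype NR] [Fintype NI]
    [Nonempty NC] [Nonempty NR] [Nonempty NI]
    (ε s : ℝ) (hε : 0 < ε) (hs : ε ≤ s / 8)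
    (K : DLLite.KB NC NR NI) (hK : K.Satisfiable)
    (d : ℕ)
    (hd : Fintype.card NC +
      Fintype.card NR * (2 + Fintype.card NI + 2 * Fintype.card NR) ≤ d) :
    ∃ η : DLLite.BoxInterp NC NR NI d ε s, η.IsKBFaithfulModel K := by
  -- One coordinate per basic concept is enough; surplus coordinates repeat labels.
  have hcard : Fintype.card NC + 2 * Fintype.card NR ≤ d := by nlinarith
  obtain ⟨π, hπ⟩ := DLLite.BasicConcept.exists_surjective (NC := NC) (NR := NR) hcard
  have hpos : 0 < Fintype.card NC := Fintype.card_pos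
  exact ⟨DLLite.boxModel K π hε hs ⟨0, by omega⟩,
    DLLite.boxModel_kbFaithful hε hs _ hK hπ, DLLite.boxModel_kbEntailed hε hs _ hK hπ⟩
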